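/- All systems are finite-dimensional, $\log$ is the base-$2$ logarithm, and real powers of a positive semidefinite operator are taken on its support (so negative powers are powers of the generalized inverse). For $\alpha\in(0,1)\cup(1,\infty)$ and positive semidefinite $\rho\neq 0$ and $\sigma$, let $$\widetilde D_\alpha(\rho\|\sigma)=\frac{1}{\alpha-1}\log\frac{\operatorname{Tr}\big[\big(\sigma^{\frac{1-\alpha}{2\alpha}}\rho\,\sigma^{\frac{1-\alpha}{2\alpha}}\big)^{\alpha}\big]}{\operatorname{Tr}[\rho]},\qquad \bar D_\alpha(\rho\|\sigma)=\frac{1}{\alpha-1}\log\frac{\operatorname{Tr}[\rho^\alpha\sigma^{1-\alpha}]}{\operatorname{Tr}[\rho]}$$ if ($\alpha<1$ and $\rho\not\perp\sigma$) or $\operatorname{supp}(\rho)\subseteq\operatorname{supp}(\sigma)$, and let both be $+\infty$ otherwise. For a normalized state $\rho_{AB}$ put $\widetilde H^{\downarrow}_\alpha(A|B)_\rho=-\widetilde D_\alpha(\rho_{AB}\|I_A\otimes\rho_B)$ and $\bar H^{\downarrow}_\alpha(A|B)_\rho=-\bar D_\alpha(\rho_{AB}\|I_A\otimes\rho_B)$.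 **Theorem.** Let $\rho_{QE}$ be a pure normalized state with marginal $\rho_Q=\operatorname{Tr}_E[\rho_{QE}]$, and let $Z_1,\dots,Z_{d_S}$ be orthogonal projections on $Q$ with $\sum_{j=1}^{d_S}Z_j=I_Q$. Let $V_{\mathcal Z}=\sum_j|j\rangle_S\otimes Z_j$, an isometry from $Q$ to $SQ$, where $(|j\rangle_S)_{j=1}^{d_S}$ is an orthonormal basis of $S$. Let $\sigma_{SQE}=V_{\mathcal Z}\,\rho_{QE}\,V_{\mathcal Z}^\dagger$ (with $V_{\mathcal Z}$ acting as the identity on $E$), $\sigma_{SE}=\operatorname{Tr}_Q[\sigma_{SQE}]$, and $\mathcal Z(\tau)=\sum_j Z_j\tau Z_j^\dagger$. Then $$\widetilde H^{\downarrow}_\alpha(S|E)_{\sigma}=\frac{1}{1-\alpha}\log\operatorname{Tr}\Big[\big(\mathcal Z(\rho_Q^{1/\alpha})\big)^{\alpha}\Big]\qquad\text{for all }\alpha\in(0,1)\cup(1,\infty),$$ $$\bar H^{\downarrow}_\alpha(S|E)_{\sigma}=\bar D_{2-\alpha}\big(\rho_Q\,\big\|\,\mathcal Z(\rho_Q)\big)\qquad\text{for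 all }\alpha\in(0,1)\cup(1,2).$$ -/

import Mathlib

open scoped Kronecker ComplexOrder

noncomputable section

namespace Renyi

/-- A normalized quantum state (density matrix) on the finite-dimensional system `ℂ^a`. -/
def IsState {a : Type*} [Fintype a] (ρ : Matrix a a ℂ) : Prop :=
  ρ.PosSemidef ∧ ρ.trace = 1

/-- `ρ` is pure: `ρ = |ψ⟩⟨ψ|` for some vector `ψ` (a unit vector, when `ρ` is a state). -/
def IsPure {a : Type*} (ρ : Matrix a a ℂ) : Prop :=
  ∃ ψ : a → ℂ, ρ = Matrix.vecMulVec ψ (star ψ)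

/-- Real power `A ^ p` of a positive semidefinite matrix, by functional calculus on its spectrum.
As `(0 : ℝ) ^ p = 0` for `p ≠ 0`, for such `p` the power is taken on the support of `A` (and is zero
on the kernel); in particular negative powers are powers of the generalized inverse. -/
def mpow {a : Type*} [Fintype a] [DecidableEq a] (A : Matrix a a ℂ) (p : ℝ) : Matrix a a ℂ :=
  cfc (fun x : ℝ => x ^ p) A

/-- The support of a Hermitian matrix, i.e. the orthogonal complement of its kernel: its range. -/
def supp {a : Type*} [Fintype a] (A : Matrix a a ℂ) : Submodule ℂ (a → ℂ) :=
  LinearMap.range A.mulVecLin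

/-- `ρ ⊥ σ`: orthogonality of the supports of positive semidefinite `ρ` and `σ`. -/
def Perp {a : Type*} [Fintype a] (ρ σ : Matrix a a ℂ) : Prop :=
  ρ * σ = 0

/-- The condition under which the Rényi divergences of order `α` are given by their formula
(they are `∞` otherwise). -/
def DivCondition {a : Type*} [Fintype a] (α : ℝ) (ρ σ : Matrix a a ℂ) : Prop :=
  (α < 1 ∧ ¬ Perp ρ σ) ∨ supp ρ ≤ supp σ

open Classical in
/-- The minimal (sandwiched) quantum Rényi divergence of order `α ∈ (0,1) ∪ (1,∞)` of positive
semidefinite `ρ ≠ 0` and `σ`, with base-2 logarithm. The traces are nonnegative real numbers. -/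
def sandwichedDiv {a : Type*} [Fintype a] [DecidableEq a] (α : ℝ) (ρ σ : Matrix a a ℂ) : EReal :=
  if DivCondition α ρ σ then
    ((1 / (α - 1) * Real.logb 2
      ((mpow (mpow σ ((1 - α) / (2 * α)) * ρ * mpow σ ((1 - α) / (2 * α))) α).trace.re
        / ρ.trace.re) : ℝ) : EReal)
  else ⊤

open Classical in
/-- The Petz quantum Rényi divergence of order `α ∈ (0,1) ∪ (1,∞)` of positive semidefinite `ρ ≠ 0`
and `σ`, with base-2 logarithm. The traces are nonnegative real numbers. -/
def petzDiv {a : Type*} [Fintype a] [DecidableEq a] (α : ℝ) (ρ σ : Matrix a a ℂ) : EReal :=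
  if DivCondition α ρ σ then
    ((1 / (α - 1) * Real.logb 2
      ((mpow ρ α * mpow σ (1 - α)).trace.re / ρ.trace.re) : ℝ) : EReal)
  else ⊤

/-- The marginal `ρ_B = Tr_A[ρ_AB]`. -/
def traceLeft {a b : Type*} [Fintype a] (ρ : Matrix (a × b) (a × b) ℂ) : Matrix b b ℂ :=
  Matrix.of fun j j' => ∑ i, ρ (i, j) (i, j')

/-- The marginal `ρ_A = Tr_B[ρ_AB]`. -/
def traceRight {a b : Type*} [Fintype b] (ρ : Matrix (a × b) (a × b) ℂ) : Matrix a a ℂ :=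
  Matrix.of fun i i' => ∑ j, ρ (i, j) (i', j)

/-- The marginal `σ_SE = Tr_Q[σ_SQE]` of a tripartite state. -/
def traceMiddle {s q e : Type*} [Fintype q] (σ : Matrix ((s × q) × e) ((s × q) × e) ℂ) :
    Matrix (s × e) (s × e) ℂ :=
  Matrix.of fun x y => ∑ i, σ ((x.1, i), x.2) ((y.1, i), y.2)

/-- The conditional entropy `H̃↓_α(A|B)_ρ = -D̃_α(ρ_AB ‖ I_A ⊗ ρ_B)`. -/
def sandwichedCondEntropyDown {a b : Type*} [Fintype a] [DecidableEq a] [Fintype b] [DecidableEq b]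
    (α : ℝ) (ρ : Matrix (a × b) (a × b) ℂ) : EReal :=
  -sandwichedDiv α ρ ((1 : Matrix a a ℂ) ⊗ₖ traceLeft ρ)

/-- The conditional entropy `H̄↓_α(A|B)_ρ = -D̄_α(ρ_AB ‖ I_A ⊗ ρ_B)`. -/
def petzCondEntropyDown {a b : Type*} [Fintype a] [DecidableEq a] [Fintype b] [DecidableEq b]
    (α : ℝ) (ρ : Matrix (a × b) (a × b) ℂ) : EReal :=
  -petzDiv α ρ ((1 : Matrix a a ℂ) ⊗ₖ traceLeft ρ)

/-- The isometry `V_Z = ∑ j, |j⟩_S ⊗ Z_j` from `Q` to `SQ`; `Pi.single j 1` is the ket `|j⟩`. -/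
def pinchingIsometry {s q : Type*} [Fintype s] [DecidableEq s] (Z : s → Matrix q q ℂ) :
    Matrix (s × q) q ℂ :=
  ∑ j, Matrix.of fun x y => (Pi.single j 1 : s → ℂ) x.1 * Z j x.2 y

/-- `σ_SQE = V_Z ρ_QE V_Z†`, where `V_Z` acts on `Q` and the identity acts on `E`. -/
def measuredState {s q e : Type*} [Fintype s] [DecidableEq s] [Fintype q] [Fintype e]
    [DecidableEq e] (Z : s → Matrix q q ℂ) (ρ : Matrix (q × e) (q × e) ℂ) :
    Matrix ((s × q) × e) ((s × q) × e) ℂ :=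
  (pinchingIsometry Z ⊗ₖ (1 : Matrix e e ℂ)) * ρ *
    (pinchingIsometry Z ⊗ₖ (1 : Matrix e e ℂ)).conjTranspose

/-- The pinching map `Z(τ) = ∑ j, Z_j τ Z_j†`. -/
def pinching {s q : Type*} [Fintype s] [Fintype q] (Z : s → Matrix q q ℂ) (τ : Matrix q q ℂ) :
    Matrix q q ℂ :=
  ∑ j, Z j * τ * (Z j).conjTranspose

end Renyi

end

open scoped Kronecker ComplexOrder Matrix

set_option linter.unusedSectionVars false

/-! Write the pure state's vector as a matrix `L` from `Q` to `E`, so that ρ_E = L L† and ρ_Q = (L†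
L)ᵀ. Measuring replaces `L` by W = (1 ⊗ L) · `stackTranspose Z`, with σ_SE = W W† and W† W =
Z(ρ_Q)ᵀ, while the marginal on `E` remains L L†. The key identity, `conj_stack_mpow`, is W† (1 ⊗
ρ_E^p) W = Z(ρ_Q^(1+p))ᵀ.

Sandwiched case: with B = (1 ⊗ ρ_E)^r and r = (1-α)/(2α), the matrices (BW)(BW)† and (BW)†(BW) have
equal traces of powers, and the latter is Z(ρ_Q^(1/α))ᵀ because 1 + 2r = 1/α.

Petz case: (W W†)^α = W (W† W)^(α-1) W†, so cyclicity of the trace brings in the key identity with p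
= 1-α. The pinching of ρ_Q^(2-α) then drops out, since Z(ρ_Q)^(α-1) commutes with every Z_j. -/

namespace Renyi

open Matrix Polynomial

/-! ### Functional calculus of matrices through interpolating polynomials -/

section FunctionalCalculus

variable {m n : Type*} [Fintype m] [DecidableEq m] [Fintype n] [DecidableEq n]

lemma exists_polynomial_eval_eq (f : ℝ → ℝ) {S : Set ℝ} (hS : S.Finite) :
    ∃ p : ℝ[X], ∀ x ∈ S, p.eval x = f x :=
  ⟨Lagrange.interpolate hS.toFinset id f, fun _ hx =>
    Lagrange.eval_interpolate_at_node (v := id) f (Function.injective_id.injOn)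
      (hS.mem_toFinset.2 hx)⟩

lemma cfc_eq_aeval {A : Matrix n n ℂ} (hA : A.IsHermitian) (f : ℝ → ℝ) (p : ℝ[X])
    (hp : ∀ x ∈ spectrum ℝ A, p.eval x = f x) : cfc f A = aeval A p := by
  rw [← cfc_polynomial p A hA.isSelfAdjoint]
  exact cfc_congr fun x hx => (hp x hx).symm

/-- On two Hermitian matrices, the functional calculus is given by a common polynomial. -/
lemma exists_aeval_eq_cfc (f : ℝ → ℝ) {A : Matrix m m ℂ} {B : Matrix n n ℂ}
    (hA : A.IsHermitian) (hB : B.IsHermitian) :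
    ∃ p : ℝ[X], cfc f A = aeval A p ∧ cfc f B = aeval B p := by
  obtain ⟨p, hp⟩ := exists_polynomial_eval_eq f
    ((Matrix.finite_real_spectrum (A := A)).union (Matrix.finite_real_spectrum (A := B)))
  exact ⟨p, cfc_eq_aeval hA f p fun x hx => hp x (Or.inl hx),
    cfc_eq_aeval hB f p fun x hx => hp x (Or.inr hx)⟩

lemma mul_aeval_of_intertwine {A : Matrix m m ℂ} {B : Matrix n n ℂ} {X : Matrix n m ℂ}
    (h : X * A = B * X) (p : ℝ[X]) : X * aeval A p = aeval B p * X := by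
  induction p using Polynomial.induction_on' with
  | add p q hp hq => simp only [map_add, Matrix.mul_add, Matrix.add_mul, hp, hq]
  | monomial k a =>
    have hk : X * A ^ k = B ^ k * X := by
      induction k with
      | zero => simp
      | succ k ih => rw [pow_succ, ← Matrix.mul_assoc, ih, Matrix.mul_assoc, h,
          ← Matrix.mul_assoc, ← pow_succ]
    simp only [aeval_monomial, Algebra.algebraMap_eq_smul_one, Matrix.smul_mul, Matrix.one_mul,
      Matrix.mul_smul, hk]

lemma mul_cfc_of_intertwine (f : ℝ → ℝ) {A : Matrix m m ℂ} {B : Matrix n n ℂ}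
    (hA : A.IsHermitian) (hB : B.IsHermitian) {X : Matrix n m ℂ} (h : X * A = B * X) :
    X * cfc f A = cfc f B * X := by
  obtain ⟨p, h₁, h₂⟩ := exists_aeval_eq_cfc f hA hB
  rw [h₁, h₂, mul_aeval_of_intertwine h]

/-- Transposition reverses products, but the powers of a single matrix commute, so it respects
polynomials. -/
lemma cfc_transpose (f : ℝ → ℝ) {A : Matrix n n ℂ} (hA : A.IsHermitian) :
    cfc f Aᵀ = (cfc f A)ᵀ := by
  obtain ⟨p, h₁, h₂⟩ := exists_aeval_eq_cfc f hA hA.transpose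
  rw [h₁, h₂]
  induction p using Polynomial.induction_on' generalizing f with
  | add p q hp hq =>
    clear h₁ h₂
    -- The induction hypotheses ask for a function represented by each summand; its own evaluation
    -- map serves.
    have aux : ∀ p : ℝ[X], aeval A p = cfc p.eval A ∧ aeval Aᵀ p = cfc p.eval Aᵀ := fun p =>
      ⟨(cfc_polynomial p A hA.isSelfAdjoint).symm,
        (cfc_polynomial p Aᵀ hA.transpose.isSelfAdjoint).symm⟩
    rw [map_add, map_add, transpose_add, hp _ (aux p).1.symm (aux p).2.symm,
      hq _ (aux q).1.symm (aux q).2.symm]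
  | monomial k a =>
    simp only [aeval_monomial, Algebra.algebraMap_eq_smul_one, Matrix.smul_mul, Matrix.one_mul,
      transpose_smul, transpose_pow]

lemma aeval_one_kronecker (A : Matrix n n ℂ) (p : ℝ[X]) :
    aeval ((1 : Matrix m m ℂ) ⊗ₖ A) p = (1 : Matrix m m ℂ) ⊗ₖ aeval A p := by
  induction p using Polynomial.induction_on' with
  | add p q hp hq => simp only [map_add, kronecker_add, hp, hq]
  | monomial k a =>
    have hk : ((1 : Matrix m m ℂ) ⊗ₖ A) ^ k = (1 : Matrix m m ℂ) ⊗ₖ (A ^ k) := by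
      induction k with
      | zero => simp
      | succ k ih => rw [pow_succ, ih, ← mul_kronecker_mul, ← pow_succ, Matrix.one_mul]
    simp only [aeval_monomial, Algebra.algebraMap_eq_smul_one, Matrix.smul_mul, Matrix.one_mul,
      hk, kronecker_smul]

lemma isHermitian_one_kronecker {A : Matrix n n ℂ} (hA : A.IsHermitian) :
    ((1 : Matrix m m ℂ) ⊗ₖ A).IsHermitian := by
  rw [IsHermitian, conjTranspose_kronecker, conjTranspose_one, hA.eq]

lemma cfc_one_kronecker (f : ℝ → ℝ) {A : Matrix n n ℂ} (hA : A.IsHermitian) :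
    cfc f ((1 : Matrix m m ℂ) ⊗ₖ A) = (1 : Matrix m m ℂ) ⊗ₖ cfc f A := by
  obtain ⟨p, h₁, h₂⟩ := exists_aeval_eq_cfc f hA (isHermitian_one_kronecker (m := m) hA)
  rw [h₁, h₂, aeval_one_kronecker]

lemma cfc_mul_matrix (f g : ℝ → ℝ) (A : Matrix n n ℂ) :
    cfc (fun x => f x * g x) A = cfc f A * cfc g A :=
  cfc_mul f g A (Matrix.finite_real_spectrum.continuousOn _)
    (Matrix.finite_real_spectrum.continuousOn _)

/-- `X g(X† X) X† = (x g(x))(X X†)`. -/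
lemma mul_cfc_mul_conjTranspose (g : ℝ → ℝ) (X : Matrix m n ℂ) :
    X * cfc g (Xᴴ * X) * Xᴴ = cfc (fun x => x * g x) (X * Xᴴ) := by
  have hX := isHermitian_mul_conjTranspose_self X
  rw [mul_cfc_of_intertwine g (isHermitian_conjTranspose_mul_self X) hX
    (Matrix.mul_assoc X Xᴴ X).symm, Matrix.mul_assoc]
  have h : cfc (fun x => x * g x) (X * Xᴴ) = cfc (fun x => g x * id x) (X * Xᴴ) := by
    congr 1; ext x; exact mul_comm _ _
  rw [h, cfc_mul_matrix, cfc_id ℝ (X * Xᴴ) hX.isSelfAdjoint]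

lemma mpow_isHermitian (A : Matrix n n ℂ) (p : ℝ) : (mpow A p).IsHermitian :=
  cfc_predicate (R := ℝ) (p := IsSelfAdjoint) _ A

lemma cfc_congr_nonneg {f g : ℝ → ℝ} {A : Matrix n n ℂ} (hA : A.PosSemidef)
    (h : ∀ x, 0 ≤ x → f x = g x) : cfc f A = cfc g A := by
  refine cfc_congr fun x hx => h x ?_
  rw [hA.isHermitian.spectrum_real_eq_range_eigenvalues] at hx
  obtain ⟨i, rfl⟩ := hx
  exact hA.eigenvalues_nonneg i

/-- The conditions handle x = 0, where `0 ^ 0 = 1` would break the law; b = 0 is harmless. -/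
lemma _root_.Real.rpow_mul_rpow_of_ne {x a b : ℝ} (hx : 0 ≤ x) (ha : a ≠ 0) (hab : a + b ≠ 0) :
    x ^ a * x ^ b = x ^ (a + b) := by
  rcases hx.eq_or_lt with rfl | h
  · rw [Real.zero_rpow ha, Real.zero_rpow hab, zero_mul]
  · rw [Real.rpow_add h]

lemma mpow_mul_mpow {A : Matrix n n ℂ} (hA : A.PosSemidef) {a b : ℝ} (ha : a ≠ 0)
    (hab : a + b ≠ 0) : mpow A a * mpow A b = mpow A (a + b) := by
  unfold mpow
  rw [← cfc_mul_matrix]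
  exact cfc_congr_nonneg hA fun x hx => Real.rpow_mul_rpow_of_ne hx ha hab

/-- The exponent p = -1 must be excluded: the left side is then the projection onto the range of
`X`, whereas `mpow _ 0` is the identity. -/
lemma mul_mpow_mul_conjTranspose (X : Matrix m n ℂ) {p : ℝ} (hp : 1 + p ≠ 0) :
    X * mpow (Xᴴ * X) p * Xᴴ = mpow (X * Xᴴ) (1 + p) := by
  unfold mpow
  rw [mul_cfc_mul_conjTranspose]
  refine cfc_congr_nonneg (posSemidef_self_mul_conjTranspose X) fun x hx => ?_
  rw [← Real.rpow_mul_rpow_of_ne hx one_ne_zero hp, Real.rpow_one]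

/-- Cyclicity applied to (X X†)^p = X (X† X)^(p-1) X†; no comparison of eigenvalues is needed. -/
lemma trace_mpow_mul_conjTranspose_comm (X : Matrix m n ℂ) {p : ℝ} (hp : p ≠ 0) :
    (mpow (X * Xᴴ) p).trace = (mpow (Xᴴ * X) p).trace := by
  have hp' : 1 + (p - 1) = p := by ring
  have h := mul_mpow_mul_conjTranspose X (p := p - 1) (by rwa [hp'])
  have hA := posSemidef_conjTranspose_mul_self X
  rw [hp'] at h
  rw [← h, Matrix.trace_mul_comm, ← Matrix.mul_assoc]
  congr 1
  nth_rewrite 1 [show Xᴴ * X = mpow (Xᴴ * X) 1 by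
    simp only [mpow, Real.rpow_one]
    exact (cfc_id' ℝ (Xᴴ * X) hA.isHermitian.isSelfAdjoint).symm]
  rw [mpow_mul_mpow hA one_ne_zero (by rwa [hp']), hp']

lemma mpow_transpose {A : Matrix n n ℂ} (hA : A.IsHermitian) (p : ℝ) :
    mpow Aᵀ p = (mpow A p)ᵀ :=
  cfc_transpose _ hA

lemma mpow_one_kronecker {A : Matrix n n ℂ} (hA : A.IsHermitian) (p : ℝ) :
    mpow ((1 : Matrix m m ℂ) ⊗ₖ A) p = (1 : Matrix m m ℂ) ⊗ₖ mpow A p :=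
  cfc_one_kronecker _ hA

end FunctionalCalculus

/-! ### Supports of Gram matrices -/

section Support

variable {l m n : Type*} [Fintype l] [Fintype m] [Fintype n]

lemma range_mulVecLin_mul_conjTranspose (X : Matrix m n ℂ) :
    LinearMap.range (X * Xᴴ).mulVecLin = LinearMap.range X.mulVecLin := by
  refine Submodule.eq_of_le_of_finrank_eq ?_ (rank_self_mul_conjTranspose X)
  rw [mulVecLin_mul]
  exact LinearMap.range_comp_le_range _ _

lemma supp_mul_conjTranspose_mono {X : Matrix m n ℂ} {A : Matrix m l ℂ} {B : Matrix l n ℂ}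
    (h : X = A * B) : supp (X * Xᴴ) ≤ supp (A * Aᴴ) := by
  unfold supp
  rw [range_mulVecLin_mul_conjTranspose, range_mulVecLin_mul_conjTranspose, h, mulVecLin_mul]
  exact LinearMap.range_comp_le_range _ _

end Support

/-! ### Orthogonal projections and pinching -/

section Projections

variable {s q : Type*} [Fintype s] [DecidableEq s] [Fintype q] [DecidableEq q]

/-- Orthogonal projections that sum to the identity are mutually orthogonal. -/
lemma mul_eq_zero_of_sum_eq_one {Z : s → Matrix q q ℂ}
    (hZ : ∀ j, (Z j).IsHermitian ∧ Z j * Z j = Z j) (hZsum : ∑ j, Z j = 1) {i j : s}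
    (hij : i ≠ j) : Z i * Z j = 0 := by
  have hpos : ∀ k, ((Z k * Z j)ᴴ * (Z k * Z j)).PosSemidef := fun k =>
    posSemidef_conjTranspose_mul_self _
  have hk : ∀ k, (Z k * Z j)ᴴ * (Z k * Z j) = Z j * Z k * Z j := fun k => by
    rw [conjTranspose_mul, (hZ k).1.eq, (hZ j).1.eq, Matrix.mul_assoc, ← Matrix.mul_assoc (Z k),
      (hZ k).2, Matrix.mul_assoc]
  -- The term k = j already equals Z_j, so the other positive terms sum to zero and each has trace
  -- zero.
  have hsum : ∑ k, ((Z k * Z j)ᴴ * (Z k * Z j)) = Z j := by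
    simp only [hk]
    rw [← Finset.sum_mul, ← Finset.mul_sum, hZsum, Matrix.mul_one, (hZ j).2]
  have hzero : ∑ k ∈ Finset.univ.erase j, ((Z k * Z j)ᴴ * (Z k * Z j)).trace = 0 := by
    rw [← trace_sum]
    have h := Finset.add_sum_erase Finset.univ (fun k => (Z k * Z j)ᴴ * (Z k * Z j))
      (Finset.mem_univ j)
    rw [hsum, hk, (hZ j).2, (hZ j).2] at h
    rw [left_eq_add.1 h.symm, trace_zero]
  have h := (Finset.sum_eq_zero_iff_of_nonneg fun k _ => (hpos k).trace_nonneg).1 hzero i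
    (Finset.mem_erase.2 ⟨hij, Finset.mem_univ i⟩)
  exact trace_conjTranspose_mul_self_eq_zero_iff.1 h

lemma commute_pinching {Z : s → Matrix q q ℂ}
    (hZ : ∀ j, (Z j).IsHermitian ∧ Z j * Z j = Z j) (hZsum : ∑ j, Z j = 1) (T : Matrix q q ℂ)
    (j : s) : Z j * pinching Z T = pinching Z T * Z j := by
  have h₁ : Z j * pinching Z T = Z j * T * Z j := by
    unfold pinching
    rw [Finset.mul_sum, Finset.sum_eq_single j]
    · rw [(hZ j).1.eq, ← Matrix.mul_assoc, ← Matrix.mul_assoc, (hZ j).2]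
    · intro k _ hk
      rw [← Matrix.mul_assoc, ← Matrix.mul_assoc, mul_eq_zero_of_sum_eq_one hZ hZsum hk.symm,
        Matrix.zero_mul, Matrix.zero_mul]
    · exact fun h => absurd (Finset.mem_univ j) h
  have h₂ : pinching Z T * Z j = Z j * T * Z j := by
    unfold pinching
    rw [Finset.sum_mul, Finset.sum_eq_single j]
    · rw [(hZ j).1.eq, Matrix.mul_assoc, (hZ j).2]
    · intro k _ hk
      rw [(hZ k).1.eq, Matrix.mul_assoc, mul_eq_zero_of_sum_eq_one hZ hZsum hk, Matrix.mul_zero]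
    · exact fun h => absurd (Finset.mem_univ j) h
  rw [h₁, h₂]

lemma pinching_isHermitian (Z : s → Matrix q q ℂ) {T : Matrix q q ℂ} (hT : T.IsHermitian) :
    (pinching Z T).IsHermitian := by
  unfold pinching
  rw [IsHermitian, conjTranspose_sum]
  refine Finset.sum_congr rfl fun j _ => ?_
  rw [conjTranspose_mul, conjTranspose_mul, conjTranspose_conjTranspose, hT.eq, Matrix.mul_assoc]

/-- The pinching is self-adjoint for the trace pairing, and fixes functions of a pinched matrix. -/
lemma trace_pinching_mul_mpow {Z : s → Matrix q q ℂ}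
    (hZ : ∀ j, (Z j).IsHermitian ∧ Z j * Z j = Z j) (hZsum : ∑ j, Z j = 1) (R : Matrix q q ℂ)
    {T : Matrix q q ℂ} (hT : T.IsHermitian) (p : ℝ) :
    (pinching Z R * mpow (pinching Z T) p).trace = (R * mpow (pinching Z T) p).trace := by
  have hP := pinching_isHermitian Z hT
  have hcomm : ∀ j, Z j * mpow (pinching Z T) p = mpow (pinching Z T) p * Z j := fun j =>
    mul_cfc_of_intertwine _ hP hP (commute_pinching hZ hZsum T j)
  set G := mpow (pinching Z T) p
  -- Cyclicity brings both copies of Z_j around `G`, where they commute past it and merge into one.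
  have hj : ∀ j, (Z j * R * (Z j)ᴴ * G).trace = (R * G * Z j).trace := fun j => by
    rw [(hZ j).1.eq, Matrix.mul_assoc, Matrix.mul_assoc, Matrix.trace_mul_comm, Matrix.mul_assoc,
      Matrix.mul_assoc, ← hcomm, ← Matrix.mul_assoc (Z j), (hZ j).2, hcomm, ← Matrix.mul_assoc]
  unfold pinching
  rw [Finset.sum_mul, trace_sum]
  simp only [hj]
  rw [← trace_sum, ← Finset.mul_sum, hZsum, Matrix.mul_one]

end Projections

/-! ### The measured state as W W†, and the transfer of traces from SE to Q -/

section Purification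

variable {s q e : Type*} [Fintype s] [DecidableEq s] [Fintype q] [DecidableEq q]
  [Fintype e] [DecidableEq e]

/-- The column of the transposed projections. -/
def stackTranspose (Z : s → Matrix q q ℂ) : Matrix (s × q) q ℂ :=
  Matrix.of fun x y => Z x.1 y x.2

/-- The coefficients `⟨x, y|ψ⟩` of a bipartite vector, as a matrix from `Q` to `E`. -/
def coeffMatrix (ψ : q × e → ℂ) : Matrix e q ℂ :=
  Matrix.of fun y x => ψ (x, y)

lemma stackTranspose_conj (Z : s → Matrix q q ℂ) (T : Matrix q q ℂ) :
    (stackTranspose Z)ᴴ * ((1 : Matrix s s ℂ) ⊗ₖ Tᵀ) * stackTranspose Z = (pinching Z T)ᵀ := by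
  have h : ((1 : Matrix s s ℂ) ⊗ₖ Tᵀ) * stackTranspose Z
      = Matrix.of fun x y => (Z x.1 * T) y x.2 := by
    ext ⟨j, x⟩ y
    simp only [Matrix.mul_apply, stackTranspose, Fintype.sum_prod_type, kroneckerMap_apply,
      one_apply, of_apply, transpose_apply]
    rw [Finset.sum_eq_single j]
    · simp [mul_comm]
    · intro k _ hk
      simp [hk.symm]
    · simp
  rw [Matrix.mul_assoc, h]
  ext x y
  rw [Matrix.mul_apply, Fintype.sum_prod_type, transpose_apply, pinching, Matrix.sum_apply]
  refine Finset.sum_congr rfl fun j _ => ?_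
  rw [Matrix.mul_apply]
  exact Finset.sum_congr rfl fun k _ => mul_comm _ _

lemma traceRight_vecMulVec (ψ : q × e → ℂ) :
    traceRight (vecMulVec ψ (star ψ)) = ((coeffMatrix ψ)ᴴ * coeffMatrix ψ)ᵀ := by
  ext x x'
  simp [traceRight, coeffMatrix, Matrix.mul_apply, vecMulVec_apply, mul_comm]

/-- `σ_SE = W W†`, where `W` is the measured vector viewed as a matrix from `Q` to `SE`. -/
lemma traceMiddle_measuredState (Z : s → Matrix q q ℂ) (ψ : q × e → ℂ) :
    traceMiddle (measuredState Z (vecMulVec ψ (star ψ))) =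
      (((1 : Matrix s s ℂ) ⊗ₖ coeffMatrix ψ) * stackTranspose Z) *
        (((1 : Matrix s s ℂ) ⊗ₖ coeffMatrix ψ) * stackTranspose Z)ᴴ := by
  have hφ : ∀ j x y, ((pinchingIsometry Z ⊗ₖ (1 : Matrix e e ℂ)) *ᵥ ψ) ((j, x), y) =
      (((1 : Matrix s s ℂ) ⊗ₖ coeffMatrix ψ) * stackTranspose Z) (j, y) x := by
    intro j x y
    simp only [mulVec, dotProduct, Matrix.mul_apply, Fintype.sum_prod_type, kroneckerMap_apply,
      pinchingIsometry, stackTranspose, coeffMatrix, Matrix.sum_apply, of_apply, one_apply,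
      Pi.single_apply]
    simp [mul_comm]
  rw [measuredState, mul_vecMulVec, vecMulVec_mul, ← star_mulVec]
  ext ⟨j, y⟩ ⟨j', y'⟩
  simp only [traceMiddle, of_apply, vecMulVec_apply, Pi.star_apply, hφ]
  rw [Matrix.mul_apply]
  rfl

/-- The measurement acts on `Q` alone: the blocks L Z_jᵀ contribute L Z_jᵀ L†, and the projections
sum to the identity. -/
lemma traceLeft_stack {Z : s → Matrix q q ℂ}
    (hZ : ∀ j, (Z j).IsHermitian ∧ Z j * Z j = Z j) (hZsum : ∑ j, Z j = 1) (L : Matrix e q ℂ) :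
    traceLeft ((((1 : Matrix s s ℂ) ⊗ₖ L) * stackTranspose Z) *
      (((1 : Matrix s s ℂ) ⊗ₖ L) * stackTranspose Z)ᴴ) = L * Lᴴ := by
  have hW : ∀ j y x, (((1 : Matrix s s ℂ) ⊗ₖ L) * stackTranspose Z) (j, y) x
      = (L * (Z j)ᵀ) y x := by
    intro j y x
    simp [Matrix.mul_apply, Fintype.sum_prod_type, stackTranspose, one_apply]
  have hsum : traceLeft ((((1 : Matrix s s ℂ) ⊗ₖ L) * stackTranspose Z) *
      (((1 : Matrix s s ℂ) ⊗ₖ L) * stackTranspose Z)ᴴ)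
      = ∑ j, (L * (Z j)ᵀ) * (L * (Z j)ᵀ)ᴴ := by
    ext y y'
    rw [Matrix.sum_apply]
    simp only [traceLeft, of_apply]
    refine Finset.sum_congr rfl fun j _ => ?_
    rw [Matrix.mul_apply, Matrix.mul_apply]
    simp only [conjTranspose_apply, hW]
  have hj : ∀ j, (L * (Z j)ᵀ) * (L * (Z j)ᵀ)ᴴ = L * (Z j)ᵀ * Lᴴ := fun j => by
    rw [conjTranspose_mul, (hZ j).1.transpose.eq, Matrix.mul_assoc, ← Matrix.mul_assoc (Z j)ᵀ,
      ← transpose_mul, (hZ j).2, Matrix.mul_assoc]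
  rw [hsum]
  simp only [hj]
  rw [← Matrix.sum_mul, ← Matrix.mul_sum, ← transpose_sum, hZsum, transpose_one, Matrix.mul_one]

/-- Powers of `ρ_E` are pulled back to pinched powers of `ρ_Q`. -/
lemma conj_stack_mpow (Z : s → Matrix q q ℂ) (L : Matrix e q ℂ) {p : ℝ} (hp : 1 + p ≠ 0) :
    (((1 : Matrix s s ℂ) ⊗ₖ L) * stackTranspose Z)ᴴ * ((1 : Matrix s s ℂ) ⊗ₖ mpow (L * Lᴴ) p) *
      (((1 : Matrix s s ℂ) ⊗ₖ L) * stackTranspose Z) =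
      (pinching Z (mpow (Lᴴ * L)ᵀ (1 + p)))ᵀ := by
  have h := mul_mpow_mul_conjTranspose Lᴴ hp
  rw [conjTranspose_conjTranspose] at h
  rw [← stackTranspose_conj, mpow_transpose (isHermitian_conjTranspose_mul_self L),
    transpose_transpose, ← h, conjTranspose_mul, conjTranspose_kronecker, conjTranspose_one]
  simp only [Matrix.mul_assoc]
  congr 1
  simp only [← Matrix.mul_assoc, ← mul_kronecker_mul, Matrix.one_mul]

lemma stack_gram (Z : s → Matrix q q ℂ) (L : Matrix e q ℂ) :
    (((1 : Matrix s s ℂ) ⊗ₖ L) * stackTranspose Z)ᴴ *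
      (((1 : Matrix s s ℂ) ⊗ₖ L) * stackTranspose Z) = (pinching Z (Lᴴ * L)ᵀ)ᵀ := by
  rw [← stackTranspose_conj, transpose_transpose, conjTranspose_mul, conjTranspose_kronecker,
    conjTranspose_one]
  simp only [Matrix.mul_assoc]
  congr 1
  simp only [← Matrix.mul_assoc, ← mul_kronecker_mul, Matrix.one_mul]

/-- W factors through 1 ⊗ L on the left, so its range can only shrink. -/
lemma supp_stack_le (Z : s → Matrix q q ℂ) (L : Matrix e q ℂ) :
    supp ((((1 : Matrix s s ℂ) ⊗ₖ L) * stackTranspose Z) *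
      (((1 : Matrix s s ℂ) ⊗ₖ L) * stackTranspose Z)ᴴ) ≤ supp ((1 : Matrix s s ℂ) ⊗ₖ (L * Lᴴ)) := by
  have h : (1 : Matrix s s ℂ) ⊗ₖ (L * Lᴴ) =
      ((1 : Matrix s s ℂ) ⊗ₖ L) * ((1 : Matrix s s ℂ) ⊗ₖ L)ᴴ := by
    rw [conjTranspose_kronecker, conjTranspose_one, ← mul_kronecker_mul, Matrix.one_mul]
  rw [h]
  exact supp_mul_conjTranspose_mono rfl

/-- The support of `ρ` is contained in the support of its pinching. -/
lemma supp_le_supp_pinching {Z : s → Matrix q q ℂ} (hZsum : ∑ j, Z j = 1) (M : Matrix q e ℂ) :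
    supp (M * Mᴴ) ≤ supp (pinching Z (M * Mᴴ)) := by
  -- `Y` is the block row of the Z_j M and `J` the block column of identities, so Y J = ∑ Z_j M = M.
  let Y : Matrix q (s × e) ℂ := Matrix.of fun x y => (Z y.1 * M) x y.2
  let J : Matrix (s × e) e ℂ := Matrix.of fun x y => (1 : Matrix e e ℂ) x.2 y
  have hY : pinching Z (M * Mᴴ) = Y * Yᴴ := by
    have hj : ∀ j, Z j * (M * Mᴴ) * (Z j)ᴴ = (Z j * M) * (Z j * M)ᴴ := fun j => by
      rw [conjTranspose_mul]; simp only [Matrix.mul_assoc]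
    ext x x'
    rw [pinching, Matrix.sum_apply, Matrix.mul_apply, Fintype.sum_prod_type]
    refine Finset.sum_congr rfl fun j _ => ?_
    rw [hj, Matrix.mul_apply]
    rfl
  have hJ : M = Y * J := by
    have hM : M = ∑ j, Z j * M := by rw [← Matrix.sum_mul, hZsum, Matrix.one_mul]
    ext x y
    conv_lhs => rw [hM]
    rw [Matrix.sum_apply, Matrix.mul_apply, Fintype.sum_prod_type]
    refine Finset.sum_congr rfl fun j _ => ?_
    simp [Y, J, one_apply]
  rw [hY]
  exact supp_mul_conjTranspose_mono hJ

lemma trace_stack {Z : s → Matrix q q ℂ}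
    (hZ : ∀ j, (Z j).IsHermitian ∧ Z j * Z j = Z j) (hZsum : ∑ j, Z j = 1) (L : Matrix e q ℂ) :
    ((((1 : Matrix s s ℂ) ⊗ₖ L) * stackTranspose Z) *
      (((1 : Matrix s s ℂ) ⊗ₖ L) * stackTranspose Z)ᴴ).trace = (L * Lᴴ).trace := by
  conv_rhs => rw [← traceLeft_stack hZ hZsum L]
  simp only [Matrix.trace, diag_apply, traceLeft, of_apply, Fintype.sum_prod_type]
  exact Finset.sum_comm

lemma trace_coeffMatrix (ψ : q × e → ℂ) :
    (coeffMatrix ψ * (coeffMatrix ψ)ᴴ).trace = (vecMulVec ψ (star ψ)).trace := by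
  simp only [Matrix.trace, diag_apply, Matrix.mul_apply, vecMulVec_apply, Fintype.sum_prod_type,
    coeffMatrix, of_apply, conjTranspose_apply, Pi.star_apply]
  exact Finset.sum_comm

lemma trace_mpow_sandwiched_stack (Z : s → Matrix q q ℂ) (L : Matrix e q ℂ) {α : ℝ}
    (h0 : 0 < α) (h1 : α ≠ 1) :
    (mpow (mpow ((1 : Matrix s s ℂ) ⊗ₖ (L * Lᴴ)) ((1 - α) / (2 * α)) *
      ((((1 : Matrix s s ℂ) ⊗ₖ L) * stackTranspose Z) *
        (((1 : Matrix s s ℂ) ⊗ₖ L) * stackTranspose Z)ᴴ) *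
      mpow ((1 : Matrix s s ℂ) ⊗ₖ (L * Lᴴ)) ((1 - α) / (2 * α))) α).trace =
      (mpow (pinching Z (mpow (Lᴴ * L)ᵀ (1 / α))) α).trace := by
  have hs : (1 - α) / (2 * α) ≠ 0 := div_ne_zero (sub_ne_zero.2 h1.symm) (by positivity)
  -- Conjugating by `W` adds 1 to the exponent 2r of ρ_E, which produces the power 1/α of ρ_Q.
  have hss : 1 + ((1 - α) / (2 * α) + (1 - α) / (2 * α)) = 1 / α := by field_simp; ring
  set W := ((1 : Matrix s s ℂ) ⊗ₖ L) * stackTranspose Z with hW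
  set r := (1 - α) / (2 * α)
  have hB := mpow_isHermitian ((1 : Matrix s s ℂ) ⊗ₖ (L * Lᴴ)) r
  have hBB : mpow ((1 : Matrix s s ℂ) ⊗ₖ (L * Lᴴ)) r * mpow ((1 : Matrix s s ℂ) ⊗ₖ (L * Lᴴ)) r =
      (1 : Matrix s s ℂ) ⊗ₖ mpow (L * Lᴴ) (r + r) := by
    rw [mpow_one_kronecker (isHermitian_mul_conjTranspose_self L), ← mul_kronecker_mul,
      Matrix.one_mul, mpow_mul_mpow (posSemidef_self_mul_conjTranspose L) hs
        (by rw [← two_mul]; exact mul_ne_zero two_ne_zero hs)]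
  set B := mpow ((1 : Matrix s s ℂ) ⊗ₖ (L * Lᴴ)) r
  have hprod : B * (W * Wᴴ) * B = (B * W) * (B * W)ᴴ := by
    rw [conjTranspose_mul B, hB.eq]; simp only [Matrix.mul_assoc]
  have hgram : (B * W)ᴴ * (B * W) = (pinching Z (mpow (Lᴴ * L)ᵀ (1 / α)))ᵀ := by
    rw [← hss, ← conj_stack_mpow Z L (by rw [hss]; positivity), ← hW, ← hBB, conjTranspose_mul B,
      hB.eq]
    simp only [Matrix.mul_assoc]
  rw [hprod, trace_mpow_mul_conjTranspose_comm _ h0.ne', hgram,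
    mpow_transpose (pinching_isHermitian Z (mpow_isHermitian _ _)), trace_transpose]

lemma trace_petz_stack {Z : s → Matrix q q ℂ}
    (hZ : ∀ j, (Z j).IsHermitian ∧ Z j * Z j = Z j) (hZsum : ∑ j, Z j = 1) (L : Matrix e q ℂ)
    {α : ℝ} (h0 : 0 < α) (h2 : α < 2) :
    (mpow ((((1 : Matrix s s ℂ) ⊗ₖ L) * stackTranspose Z) *
        (((1 : Matrix s s ℂ) ⊗ₖ L) * stackTranspose Z)ᴴ) α *
      mpow ((1 : Matrix s s ℂ) ⊗ₖ (L * Lᴴ)) (1 - α)).trace =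
      (mpow (Lᴴ * L)ᵀ (2 - α) * mpow (pinching Z (Lᴴ * L)ᵀ) (1 - (2 - α))).trace := by
  have hL := (isHermitian_conjTranspose_mul_self L).transpose
  have hα : 1 + (1 - (2 - α)) = α := by ring
  have hα' : 1 + (1 - α) = 2 - α := by ring
  have hgram := stack_gram Z L
  -- Here α < 2 keeps the resulting exponent 2 - α away from zero.
  have hpull := conj_stack_mpow Z L (p := 1 - α) (by rw [hα']; linarith)
  rw [hα'] at hpull
  set W := ((1 : Matrix s s ℂ) ⊗ₖ L) * stackTranspose Z
  have hpow := mul_mpow_mul_conjTranspose W (p := 1 - (2 - α)) (by rw [hα]; exact h0.ne')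
  rw [hα, hgram, mpow_transpose (pinching_isHermitian Z hL)] at hpow
  rw [← hpow, mpow_one_kronecker (isHermitian_mul_conjTranspose_self L), Matrix.mul_assoc,
    Matrix.mul_assoc, Matrix.trace_mul_comm, Matrix.mul_assoc, hpull,
    ← transpose_mul, trace_transpose, trace_pinching_mul_mpow hZ hZsum _ hL]

end Purification

end Renyi

theorem mainTheorem5 {q e : Type*} [Fintype q] [DecidableEq q] [Fintype e] [DecidableEq e]
    (dS : ℕ) (Z : Fin dS → Matrix q q ℂ)
    (hZ : ∀ j, (Z j).IsHermitian ∧ Z j * Z j = Z j) (hZsum : ∑ j, Z j = 1)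
    (ρ : Matrix (q × e) (q × e) ℂ) (hρ : Renyi.IsState ρ) (hpure : Renyi.IsPure ρ) :
    (∀ α : ℝ, 0 < α → α ≠ 1 →
      Renyi.sandwichedCondEntropyDown α (Renyi.traceMiddle (Renyi.measuredState Z ρ)) =
        ((1 / (1 - α) * Real.logb 2
          (Renyi.mpow (Renyi.pinching Z (Renyi.mpow (Renyi.traceRight ρ) (1 / α))) α).trace.re : ℝ)
            : EReal)) ∧
    (∀ α : ℝ, 0 < α → α < 2 → α ≠ 1 →
      Renyi.petzCondEntropyDown α (Renyi.traceMiddle (Renyi.measuredState Z ρ)) =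
        Renyi.petzDiv (2 - α) (Renyi.traceRight ρ) (Renyi.pinching Z (Renyi.traceRight ρ))) := by
  obtain ⟨ψ, rfl⟩ := hpure
  have htr : (Renyi.coeffMatrix ψ * (Renyi.coeffMatrix ψ).conjTranspose).trace = 1 := by
    rw [Renyi.trace_coeffMatrix]; exact hρ.2
  have hσ := Renyi.trace_stack hZ hZsum (Renyi.coeffMatrix ψ)
  rw [htr] at hσ
  -- Support inclusion holds for every α, so the divergence of σ_SE never takes the value ⊤.
  have hsupp (α : ℝ) : Renyi.DivCondition α _ _ :=
    Or.inr (Renyi.supp_stack_le Z (Renyi.coeffMatrix ψ))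
  refine ⟨fun α h0 h1 => ?_, fun α h0 h2 h1 => ?_⟩
  · rw [Renyi.traceMiddle_measuredState, Renyi.sandwichedCondEntropyDown,
      Renyi.traceLeft_stack hZ hZsum, Renyi.sandwichedDiv, if_pos (hsupp α),
      Renyi.trace_mpow_sandwiched_stack Z _ h0 h1, hσ, Renyi.traceRight_vecMulVec,
      ← EReal.coe_neg, ← neg_mul, ← one_div_neg_eq_neg_one_div, neg_sub, Complex.one_re, div_one]
  -- Writing ρ_Q as M M† with M = Lᵀ gives the form that the support lemma for pinchings expects.
  · have hQ : ((Renyi.coeffMatrix ψ).conjTranspose * Renyi.coeffMatrix ψ).transpose =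
        (Renyi.coeffMatrix ψ).transpose * (Renyi.coeffMatrix ψ).transpose.conjTranspose := by
      rw [Matrix.transpose_mul]; rfl
    have hsuppQ : Renyi.DivCondition (2 - α) _ _ :=
      Or.inr (Renyi.supp_le_supp_pinching hZsum (Renyi.coeffMatrix ψ).transpose)
    rw [← hQ] at hsuppQ
    rw [Renyi.traceMiddle_measuredState, Renyi.petzCondEntropyDown,
      Renyi.traceLeft_stack hZ hZsum, Renyi.petzDiv, Renyi.petzDiv, if_pos (hsupp α),
      Renyi.traceRight_vecMulVec, if_pos hsuppQ,
      Renyi.trace_petz_stack hZ hZsum _ h0 h2, hσ, Matrix.trace_transpose,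
      Matrix.trace_mul_comm (Renyi.coeffMatrix ψ).conjTranspose, htr,
      ← EReal.coe_neg, ← neg_mul, ← one_div_neg_eq_neg_one_div]
    -- What is left is the prefactor: -(α - 1) = (2 - α) - 1.
    congr 4
    ring
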